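/- \textbf{Setting.} Let $n\ge 3$ and $1\le k\le n$. A Plackett--Luce instance on the items $[n]=\{1,\dots,n\}$ is a vector $\boldsymbol\theta=(\theta_1,\dots,\theta_n)$ of pairwise distinct scores in $(0,1]$ with $\max_i\theta_i=1$; the order of the scores is unknown to the learner. In every round a sequential, possibly randomized, algorithm chooses, depending on the rounds played so far, either a set $S\subseteq[n]$ with $|S|=k$ to play, or to stop and output a ranking. When $S$ is played, it receives full-ranking feedback: a ranking of $S$ (a bijection $\rho:S\to\{1,\dots,k\}$ that sends each item to its position), drawn, conditionally on the past and on $S$, with probability $$\Pr(\rho\mid S)=\prod_{i=1}^{k}\frac{\theta_{\rho^{-1}(i)}}{\sum_{j=i}^{k}\theta_{\rho^{-1}(j)}}.$$ The output is a permutation $\sigma$ of $[n]$, where $\sigma(i)$ is the position of item $i$. It is an $\epsilon$-best ranking for $\boldsymbol\theta$ if there are no items $i,j$ with $\sigma(i)>\sigma(j)$ and $\theta_i\ge\theta_j+\epsilon$. The algorithm is $(\epsilon,\delta)$-PAC-Rank if on every instance it stops after finitely many rounds with probability $1$ and its output is an $\epsilon$-best ranking with probability at least $1-\delta$. It is symmetric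 if for every instance $\boldsymbol\theta$, every permutation $\phi$ of $[n]$ and every ranking $\sigma$, the probability that it outputs $\sigma$ on $(\theta_1,\dots,\theta_n)$ equals the probability that it outputs $\sigma\circ\phi$ on $(\theta_{\phi(1)},\dots,\theta_{\phi(n)})$. Its sample complexity on $\boldsymbol\theta$ is the expected number of rounds played before it stops. \textbf{Corollary.} There is a universal constant $c>0$ such that for all integers $n\ge 3$ and $1\le k\le n$, all $\epsilon\in(0,1/\sqrt8]$ and $\delta\in(0,1]$, and every symmetric $(\epsilon,\delta)$-PAC-Rank algorithm with full-ranking feedback on sets of size $k$, there is a Plackett--Luce instance $\boldsymbol\theta$ on which the sample complexity of the algorithm is at least $$c\,\frac{n}{k\,\epsilon^2}\,\ln\frac{1}{4\delta}.$$ -/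

import Mathlib

open scoped ENNReal

noncomputable section

namespace PLRank

/-! ### The Plackett-Luce model -/

/-- Probability that successive Plackett-Luce draws without replacement, with item weights `w`,
produce the items in the order `u 0, u 1, …, u (k-1)`:
`∏ᵢ w (u i) / ∑_{j ≥ i} w (u j)`. -/
def rankProb {α : Type*} {k : ℕ} (w : α → ℝ) (u : Fin k → α) : ℝ :=
  ∏ i : Fin k, w (u i) / ∑ j ∈ Finset.Ici i, w (u j)

theorem rankProb_nonneg {α : Type*} {k : ℕ} {w : α → ℝ} (hw : ∀ a, 0 < w a) (u : Fin k → α) :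
    0 ≤ rankProb w u :=
  Finset.prod_nonneg fun _ _ =>
    div_nonneg (hw _).le (Finset.sum_nonneg fun _ _ => (hw _).le)

theorem rankProb_succ {α : Type*} {k : ℕ} (w : α → ℝ) (u : Fin (k + 1) → α) :
    rankProb w u = w (u 0) / (∑ j, w (u j)) * rankProb w (fun i => u i.succ) := by
  unfold rankProb
  rw [Fin.prod_univ_succ]
  congr 1
  · congr 2
    ext j
    simp
  · refine Finset.prod_congr rfl fun i _ => ?_
    congr 1
    rw [← Fin.map_succEmb_Ici, Finset.sum_map]
    rfl

theorem sum_rankProb_perm : ∀ (k : ℕ) (w : Fin k → ℝ), (∀ a, 0 < w a) →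
    ∑ e : Equiv.Perm (Fin k), rankProb w e = 1 := by
  intro k
  induction k with
  | zero => intro w _; simp [rankProb]
  | succ k ih =>
    intro w hw
    have hpos : 0 < ∑ j, w j := Finset.sum_pos (fun j _ => hw j) Finset.univ_nonempty
    rw [← Equiv.Perm.decomposeFin.symm.sum_comp (fun e => rankProb w e), Fintype.sum_prod_type]
    have key : ∀ (p : Fin (k + 1)) (e : Equiv.Perm (Fin k)),
        rankProb w (Equiv.Perm.decomposeFin.symm (p, e)) =
          w p / (∑ j, w j) * rankProb (fun i : Fin k => w (Equiv.swap 0 p i.succ)) e := by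
      intro p e
      rw [rankProb_succ, Equiv.sum_comp (Equiv.Perm.decomposeFin.symm (p, e)) w]
      simp only [Equiv.Perm.decomposeFin_symm_apply_zero,
        Equiv.Perm.decomposeFin_symm_apply_succ]
      rfl
    simp only [key, ← Finset.mul_sum]
    simp only [ih _ (fun _ => hw _), mul_one]
    rw [← Finset.sum_div, div_self hpos.ne']

theorem sum_rankProb {α : Type*} [Fintype α] [DecidableEq α] {k : ℕ} (hk : Fintype.card α = k)
    (w : α → ℝ) (hw : ∀ a, 0 < w a) :
    ∑ ρ : α ≃ Fin k, rankProb w ρ.symm = 1 := by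
  have e₀ : α ≃ Fin k := Fintype.equivFinOfCardEq hk
  rw [← sum_rankProb_perm k (fun i => w (e₀.symm i)) (fun _ => hw _)]
  refine Fintype.sum_equiv
    { toFun := fun ρ => ρ.symm.trans e₀
      invFun := fun π => e₀.trans π.symm
      left_inv := fun ρ => by ext x; simp
      right_inv := fun π => by ext x; simp } _ _ ?_
  intro ρ
  simp [rankProb]

/-- A Plackett-Luce instance on the items `Fin n`: positive scores, all different, the largest of
them equal to `1`. The items carry arbitrary labels: the order of the scores is not known. -/
structure Instance (n : ℕ) where
  score : Fin n → ℝ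
  score_pos : ∀ i, 0 < score i
  score_le_one : ∀ i, score i ≤ 1
  exists_score_eq_one : ∃ i, score i = 1
  score_injective : Function.Injective score

/-- The instance in which item `i` has the score `score (φ i)`. -/
def Instance.relabel {n : ℕ} (θ : Instance n) (φ : Equiv.Perm (Fin n)) : Instance n where
  score i := θ.score (φ i)
  score_pos i := θ.score_pos (φ i)
  score_le_one i := θ.score_le_one (φ i)
  exists_score_eq_one := by
    obtain ⟨i, hi⟩ := θ.exists_score_eq_one
    exact ⟨φ.symm i, by simpa using hi⟩
  score_injective := θ.score_injective.comp φ.injective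

/-- The sets that may be played: the `k`-element subsets of the items. -/
abbrev Query (n k : ℕ) : Type := {S : Finset (Fin n) // S.card = k}

/-- Full-ranking feedback on the played set `S`. A ranking `ρ` of `S` sends each item of `S` to its
position, so `ρ.symm 0` is the most preferred item. -/
def Instance.feedback {n k : ℕ} (θ : Instance n) (S : Query n k) : PMF (S.1 ≃ Fin k) :=
  PMF.ofFintype
    (fun ρ => ENNReal.ofReal (rankProb (fun a : S.1 => θ.score a) ρ.symm)) (by
      rw [← ENNReal.ofReal_sum_of_nonneg
          (fun _ _ => rankProb_nonneg (fun a : S.1 => θ.score_pos a) _),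
        sum_rankProb (by simpa using S.2) _ (fun a : S.1 => θ.score_pos a), ENNReal.ofReal_one])

/-! ### Sequential algorithms -/

/-- What is seen in one round: the played set and the returned ranking of it. -/
abbrev Round (n k : ℕ) : Type := Σ S : Query n k, (S.1 ≃ Fin k)

/-- A decision: play another set, or stop and output a ranking of all the items
(a permutation that sends each item to its position). -/
inductive Decision (n k : ℕ) : Type where
  | play (S : Query n k) : Decision n k
  | output (σ : Equiv.Perm (Fin n)) : Decision n k

/-- A (possibly randomized) sequential algorithm: the conditional law of the next decision, given
the rounds played so far. Histories list the most recent round first. -/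
structure Algorithm (n k : ℕ) where
  decide : List (Round n k) → PMF (Decision n k)

namespace Algorithm

variable {n k : ℕ} (A : Algorithm n k) (θ : Instance n)

/-- Probability that the first rounds played are exactly those of the given history. -/
def reachProb : List (Round n k) → ℝ≥0∞
  | [] => 1
  | r :: h => reachProb h * A.decide h (Decision.play r.1) * θ.feedback r.1 r.2

/-- Probability that the algorithm plays exactly the rounds of `h`, then stops and outputs `σ`. -/
def stopProb (h : List (Round n k)) (σ : Equiv.Perm (Fin n)) : ℝ≥0∞ :=
  A.reachProb θ h * A.decide h (Decision.output σ)

/-- Probability that the algorithm stops and outputs `σ`. -/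
def outputProb (σ : Equiv.Perm (Fin n)) : ℝ≥0∞ :=
  ∑' h : List (Round n k), A.stopProb θ h σ

/-- Probability that the algorithm stops after finitely many rounds. -/
def haltProb : ℝ≥0∞ := ∑ σ : Equiv.Perm (Fin n), A.outputProb θ σ

/-- Sample complexity: the expected number of rounds played, the number of rounds being infinite
if the algorithm never stops. -/
def expectedRounds : ℝ≥0∞ :=
  (∑' h : List (Round n k), (h.length : ℝ≥0∞) * ∑ σ : Equiv.Perm (Fin n), A.stopProb θ h σ)
    + ⊤ * (1 - A.haltProb θ)

end Algorithm

/-! ### The objective -/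

/-- No item `i` is placed behind an item `j` whose score is smaller by at least `ε`. -/
def IsEpsBestRanking {n : ℕ} (ε : ℝ) (θ : Instance n) (σ : Equiv.Perm (Fin n)) : Prop :=
  ¬ ∃ i j : Fin n, σ i > σ j ∧ θ.score i ≥ θ.score j + ε

open Classical in
/-- On every instance the algorithm stops with probability one, and outputs an `ε`-best ranking
with probability at least `1 - δ`. -/
def Algorithm.IsPACRank {n k : ℕ} (A : Algorithm n k) (ε δ : ℝ) : Prop :=
  ∀ θ : Instance n, A.haltProb θ = 1 ∧
    ENNReal.ofReal (1 - δ) ≤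
      ∑ σ : Equiv.Perm (Fin n) with IsEpsBestRanking ε θ σ, A.outputProb θ σ

/-- The law of the output does not depend on the labelling of the items: if label `i` is given to
the item formerly labelled `φ i`, then the ranking `σ` becomes `σ ∘ φ`. -/
def Algorithm.IsSymmetric {n k : ℕ} (A : Algorithm n k) : Prop :=
  ∀ (θ : Instance n) (φ σ : Equiv.Perm (Fin n)),
    A.outputProb θ σ = A.outputProb (θ.relabel φ) (φ.trans σ)

end PLRank

end

namespace PLRank

/-! The proof is a change of measure. In the base instance one item `z` has score 1 and the others
lie between `(1 - ε) ^ 2` and `1 - ε`. For each `i ≠ z`, the raised instance gives `i` score 1 and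
scales every other score by `1 - ε`. An `ε`-best ranking puts `z` before `i` in the base instance
and `i` before `z` in the raised one, so the algorithm must tell the two apart.

Plackett-Luce laws are invariant under scaling, so the two instances really differ only in the
weight of `i`. The relative entropy of a full ranking is at most a sum over items of `x - 1 - log
x`, `x` being the weight ratio (`sum_rankProb_mul_log_le_perm`). Hence a round costs at most `64 * ε
^ 2` if `i` is played and nothing otherwise. By `change_of_measure` the total cost for `i` is at
least about `log (1 / δ)`. Summing over `i`, each round is charged for at most `k` items, and `n -
1` items must be paid for.

The change of measure is done up to a finite horizon `M`, by induction on the decision tree; `M`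
tends to infinity only at the end. -/

/-! ### Relative entropy of Plackett-Luce rankings. -/

theorem rankProb_pos {α : Type*} {k : ℕ} {w : α → ℝ} (hw : ∀ a, 0 < w a) (u : Fin k → α) :
    0 < rankProb w u :=
  Finset.prod_pos fun i _ =>
    div_pos (hw _) (Finset.sum_pos (fun _ _ => hw _) ⟨i, by simp⟩)

theorem rankProb_const_mul {α : Type*} {k : ℕ} (w : α → ℝ) {c : ℝ} (hc : c ≠ 0) (u : Fin k → α) :
    rankProb (fun a => c * w a) u = rankProb w u := by
  unfold rankProb
  refine Finset.prod_congr rfl fun i _ => ?_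
  rw [← Finset.mul_sum, mul_div_mul_left _ _ hc]

theorem rankProb_decomposeFin {k : ℕ} (w : Fin (k + 1) → ℝ) (p : Fin (k + 1))
    (e : Equiv.Perm (Fin k)) :
    rankProb w (Equiv.Perm.decomposeFin.symm (p, e)) =
      w p / (∑ j, w j) * rankProb (fun i : Fin k => w (Equiv.swap 0 p i.succ)) e := by
  rw [rankProb_succ, Equiv.sum_comp (Equiv.Perm.decomposeFin.symm (p, e)) w]
  simp only [Equiv.Perm.decomposeFin_symm_apply_zero, Equiv.Perm.decomposeFin_symm_apply_succ]
  rfl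

theorem sum_swap_succ {k : ℕ} (p : Fin (k + 1)) (f : Fin (k + 1) → ℝ) :
    ∑ i : Fin k, f (Equiv.swap 0 p i.succ) = (∑ a, f a) - f p := by
  rw [← Equiv.sum_comp (Equiv.swap 0 p) f, Fin.sum_univ_succ, Equiv.swap_apply_left]
  ring

/-- The relative entropy of two Plackett-Luce rankings is at most the sum over the items of
`x - 1 - log x`, where `x` is the ratio of the weights of the item. -/
theorem sum_rankProb_mul_log_le_perm : ∀ (k : ℕ) (w w' : Fin k → ℝ), (∀ a, 0 < w a) →
    (∀ a, 0 < w' a) →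
    ∑ e : Equiv.Perm (Fin k), rankProb w e * Real.log (rankProb w e / rankProb w' e) ≤
      ∑ a, (w' a / w a - 1 - Real.log (w' a / w a)) := by
  intro k
  induction k with
  | zero => intro w w' _ _; simp [rankProb]
  | succ k ih =>
    intro w w' hw hw'
    set W := ∑ j, w j with hWdef
    set W' := ∑ j, w' j with hWdef'
    have hW : 0 < W := Finset.sum_pos (fun j _ => hw j) Finset.univ_nonempty
    have hW' : 0 < W' := Finset.sum_pos (fun j _ => hw' j) Finset.univ_nonempty
    set φ : Fin (k + 1) → ℝ := fun a => w' a / w a - 1 - Real.log (w' a / w a) with hφ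
    rw [← Equiv.Perm.decomposeFin.symm.sum_comp, Fintype.sum_prod_type]
    -- Chain rule: `p` is drawn first, with probability `w p / W`, and the remaining items form a
    -- Plackett-Luce ranking, to which the induction hypothesis applies.
    have key : ∀ p : Fin (k + 1),
        ∑ e : Equiv.Perm (Fin k), rankProb w (Equiv.Perm.decomposeFin.symm (p, e)) *
          Real.log (rankProb w (Equiv.Perm.decomposeFin.symm (p, e)) /
            rankProb w' (Equiv.Perm.decomposeFin.symm (p, e))) ≤
        w p / W * ((W' / W - 1) - Real.log (w' p / w p) + (∑ a, φ a - φ p)) := by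
      intro p
      set v : Fin k → ℝ := fun i => w (Equiv.swap 0 p i.succ)
      set v' : Fin k → ℝ := fun i => w' (Equiv.swap 0 p i.succ)
      have hv : ∀ a, 0 < v a := fun a => hw _
      have hv' : ∀ a, 0 < v' a := fun a => hw' _
      have hlog : Real.log ((w p / W) / (w' p / W')) ≤
          (W' / W - 1) - Real.log (w' p / w p) := by
        have : (w p / W) / (w' p / W') = (W' / W) / (w' p / w p) := by
          have := (hw p).ne'; have := (hw' p).ne'
          field_simp
        rw [this, Real.log_div (by positivity) (div_pos (hw' p) (hw p)).ne']
        linarith [Real.log_le_sub_one_of_pos (div_pos hW' hW)]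
      have hterm : ∀ e : Equiv.Perm (Fin k),
          rankProb w (Equiv.Perm.decomposeFin.symm (p, e)) *
          Real.log (rankProb w (Equiv.Perm.decomposeFin.symm (p, e)) /
            rankProb w' (Equiv.Perm.decomposeFin.symm (p, e))) =
          w p / W * (rankProb v e * Real.log ((w p / W) / (w' p / W')) +
            rankProb v e * Real.log (rankProb v e / rankProb v' e)) := by
        intro e
        rw [rankProb_decomposeFin, rankProb_decomposeFin, mul_div_mul_comm,
          Real.log_mul (div_pos (div_pos (hw p) hW) (div_pos (hw' p) hW')).ne'
            (div_pos (rankProb_pos hv e) (rankProb_pos hv' e)).ne']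
        ring
      rw [Finset.sum_congr rfl fun e _ => hterm e, ← Finset.mul_sum, Finset.sum_add_distrib,
        ← Finset.sum_mul, sum_rankProb_perm k v hv, one_mul]
      refine mul_le_mul_of_nonneg_left (add_le_add hlog ?_) (div_pos (hw p) hW).le
      exact (ih v v' hv hv').trans_eq (sum_swap_succ p φ)
    refine (Finset.sum_le_sum fun p _ => key p).trans_eq ?_
    -- The logarithm in `φ p` cancels that of the first draw. What is left, `W' / W` minus the mean
    -- of `w' p / w p`, vanishes on summing over `p`.
    have h1 : ∀ p, w p / W * ((W' / W - 1) - Real.log (w' p / w p) + (∑ a, φ a - φ p)) =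
        w p / W * (W' / W + ∑ a, φ a) - w' p / W := by
      intro p
      have := (hw p).ne'
      simp only [hφ]
      field_simp
      ring
    rw [Finset.sum_congr rfl fun p _ => h1 p, Finset.sum_sub_distrib, ← Finset.sum_mul,
      ← Finset.sum_div, ← Finset.sum_div, ← hWdef, ← hWdef', div_self hW.ne']
    ring

theorem sum_rankProb_mul_log_le {α : Type*} [Fintype α] [DecidableEq α] {k : ℕ}
    (hk : Fintype.card α = k) (w w' : α → ℝ) (hw : ∀ a, 0 < w a) (hw' : ∀ a, 0 < w' a) :
    ∑ ρ : α ≃ Fin k, rankProb w ρ.symm *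
        Real.log (rankProb w ρ.symm / rankProb w' ρ.symm) ≤
      ∑ a, (w' a / w a - 1 - Real.log (w' a / w a)) := by
  have e₀ : α ≃ Fin k := Fintype.equivFinOfCardEq hk
  have h := sum_rankProb_mul_log_le_perm k (fun i => w (e₀.symm i)) (fun i => w' (e₀.symm i))
    (fun _ => hw _) (fun _ => hw' _)
  rw [e₀.symm.sum_comp fun a => w' a / w a - 1 - Real.log (w' a / w a)] at h
  refine (Eq.trans_le ?_ h)
  refine Fintype.sum_equiv
    { toFun := fun ρ => ρ.symm.trans e₀
      invFun := fun π => e₀.trans π.symm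
      left_inv := fun ρ => by ext x; simp
      right_inv := fun π => by ext x; simp } _ _ ?_
  intro ρ
  simp [rankProb]


/-! ### Entropy inequalities on finite spaces. -/

/-- Jensen's inequality for the logarithm on a finite probability space. -/
theorem sum_mul_log_le_log_sum {ι : Type*} [Fintype ι] {p F : ι → ℝ} (hp : ∀ i, 0 ≤ p i)
    (h1 : ∑ i, p i = 1) (hF : ∀ i, 0 < F i) :
    ∑ i, p i * Real.log (F i) ≤ Real.log (∑ i, p i * F i) := by
  have := strictConcaveOn_log_Ioi.concaveOn.le_map_sum (t := Finset.univ) (w := p) (p := F)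
    (fun i _ => hp i) h1 (fun i _ => hF i)
  simpa [smul_eq_mul] using this

theorem sum_mul_pos_of_sum_eq_one {ι : Type*} [Fintype ι] {p F : ι → ℝ} (hp : ∀ i, 0 ≤ p i)
    (h1 : ∑ i, p i = 1) (hF : ∀ i, 0 < F i) : 0 < ∑ i, p i * F i := by
  refine (Finset.sum_nonneg fun i _ => mul_nonneg (hp i) (hF i).le).lt_of_ne' fun h => ?_
  rw [Finset.sum_eq_zero_iff_of_nonneg fun i _ => mul_nonneg (hp i) (hF i).le] at h
  have : ∀ i, p i = 0 := fun i =>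
    (mul_eq_zero.1 (h i (Finset.mem_univ i))).resolve_right (hF i).ne'
  simp [this] at h1

/-- The Gibbs variational inequality on a finite space. -/
theorem sum_mul_log_sub_le_log_sum {ι : Type*} [Fintype ι] {p q F : ι → ℝ} (hp : ∀ i, 0 < p i)
    (hq : ∀ i, 0 < q i) (h1 : ∑ i, p i = 1) (hF : ∀ i, 0 < F i) :
    ∑ i, p i * Real.log (F i) - ∑ i, p i * Real.log (p i / q i) ≤
      Real.log (∑ i, q i * F i) := by
  have h := sum_mul_log_le_log_sum (F := fun i => q i * F i / p i) (fun i => (hp i).le) h1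
    (fun i => div_pos (mul_pos (hq i) (hF i)) (hp i))
  rw [← Finset.sum_sub_distrib]
  refine (le_of_eq ?_).trans (h.trans_eq ?_)
  · refine Finset.sum_congr rfl fun i _ => ?_
    rw [Real.log_div (mul_pos (hq i) (hF i)).ne' (hp i).ne',
      Real.log_mul (hq i).ne' (hF i).ne', Real.log_div (hp i).ne' (hq i).ne']
    ring
  · congr 1
    refine Finset.sum_congr rfl fun i _ => ?_
    have := (hp i).ne'
    field_simp

/-! ### Change of measure along a truncated run. -/

variable {n k : ℕ}

/-- Decisions are sets to play or outputs. -/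
def decisionEquiv (n k : ℕ) : Query n k ⊕ Equiv.Perm (Fin n) ≃ Decision n k where
  toFun := Sum.elim Decision.play Decision.output
  invFun d := match d with
    | .play S => Sum.inl S
    | .output σ => Sum.inr σ
  left_inv x := by cases x <;> rfl
  right_inv d := by cases d <;> rfl

/-- Probability of the ranking `ρ` of the played set, as a real number. -/
noncomputable def Instance.fb (θ : Instance n) (S : Query n k) (ρ : S.1 ≃ Fin k) : ℝ :=
  rankProb (fun a : S.1 => θ.score a) ρ.symm

theorem Instance.fb_pos (θ : Instance n) (S : Query n k) (ρ : S.1 ≃ Fin k) : 0 < θ.fb S ρ :=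
  rankProb_pos (fun a : S.1 => θ.score_pos a) _

theorem Instance.sum_fb (θ : Instance n) (S : Query n k) : ∑ ρ, θ.fb S ρ = 1 :=
  sum_rankProb (by simpa using S.2) _ fun a : S.1 => θ.score_pos a

theorem Instance.toReal_feedback (θ : Instance n) (S : Query n k) (ρ : S.1 ≃ Fin k) :
    (θ.feedback S ρ).toReal = θ.fb S ρ := by
  rw [Instance.feedback, PMF.ofFintype_apply]
  exact ENNReal.toReal_ofReal (θ.fb_pos S ρ).le

namespace Algorithm

variable (A : Algorithm n k) (θ θ' : Instance n)

/-- Conditional probability of the next decision, as a real number. -/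
noncomputable def prob (h : List (Round n k)) (d : Decision n k) : ℝ := (A.decide h d).toReal

theorem prob_nonneg (h : List (Round n k)) (d : Decision n k) : 0 ≤ A.prob h d :=
  ENNReal.toReal_nonneg

theorem sum_prob (h : List (Round n k)) : ∑ x, A.prob h (decisionEquiv n k x) = 1 := by
  have h1 := (A.decide h).tsum_coe
  rw [← (decisionEquiv n k).tsum_eq, tsum_fintype] at h1
  unfold prob
  rw [← ENNReal.toReal_sum fun x _ => PMF.apply_ne_top _ _, h1, ENNReal.toReal_one]

theorem sum_prob_add (h : List (Round n k)) :
    ∑ S, A.prob h (.play S) + ∑ σ, A.prob h (.output σ) = 1 := by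
  have := A.sum_prob h
  rwa [Fintype.sum_sum_type] at this

/-- Expected total reward over at most `M` further decisions after the history `h`: reward `u σ`
for the output `σ`, reward `c S` for every play of `S`, and `b` if the algorithm has not stopped. -/
noncomputable def value (u : Equiv.Perm (Fin n) → ℝ) (c : Query n k → ℝ) (b : ℝ) :
    ℕ → List (Round n k) → ℝ
  | 0, _ => b
  | M + 1, h => ∑ S, A.prob h (.play S) *
        (c S + ∑ ρ, θ.fb S ρ * value u c b M (⟨S, ρ⟩ :: h)) +
      ∑ σ, A.prob h (.output σ) * u σ

/-- Change of measure between two instances, for the run of an algorithm up to a horizon. -/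
theorem value_le_log_value (u : Equiv.Perm (Fin n) → ℝ) (c : Query n k → ℝ)
    (hc : ∀ S, ∑ ρ, θ.fb S ρ * Real.log (θ.fb S ρ / θ'.fb S ρ) ≤ c S) (M : ℕ) :
    ∀ h, 0 < A.value θ' (fun σ => Real.exp (u σ)) 0 1 M h ∧
      A.value θ u (fun S => - c S) 0 M h ≤
        Real.log (A.value θ' (fun σ => Real.exp (u σ)) 0 1 M h) := by
  induction M with
  -- A run cut off at the horizon earns 0 under `θ` and `exp 0 = 1` under `θ'`.
  | zero => intro h; simp [value]
  | succ M ih =>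
    intro h
    set V := A.value θ u (fun S => - c S) 0 M
    set W := A.value θ' (fun σ => Real.exp (u σ)) 0 1 M
    set F : Query n k ⊕ Equiv.Perm (Fin n) → ℝ :=
      Sum.elim (fun S => ∑ ρ, θ'.fb S ρ * W (⟨S, ρ⟩ :: h)) (fun σ => Real.exp (u σ)) with hFdef
    have hF : ∀ x, 0 < F x := by
      rintro (S | σ)
      · exact sum_mul_pos_of_sum_eq_one (fun ρ => (θ'.fb_pos S ρ).le) (θ'.sum_fb S)
          fun ρ => (ih _).1
      · exact Real.exp_pos _
    have hW : A.value θ' (fun σ => Real.exp (u σ)) 0 1 (M + 1) h =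
        ∑ x, A.prob h (decisionEquiv n k x) * F x := by
      rw [Fintype.sum_sum_type]
      simp [value, F, W, decisionEquiv]
    have hV : A.value θ u (fun S => - c S) 0 (M + 1) h ≤
        ∑ x, A.prob h (decisionEquiv n k x) * Real.log (F x) := by
      rw [Fintype.sum_sum_type, value]
      refine add_le_add (Finset.sum_le_sum fun S _ => ?_) (Finset.sum_le_sum fun σ _ => ?_)
      · refine mul_le_mul_of_nonneg_left ?_ (A.prob_nonneg _ _)
        -- Only the feedback law changes between the instances, so the Gibbs inequality is paid
        -- here; decisions have the same law under both and need only Jensen.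
        have h1 := sum_mul_log_sub_le_log_sum (θ.fb_pos S) (θ'.fb_pos S) (θ.sum_fb S)
          (F := fun ρ => W (⟨S, ρ⟩ :: h)) fun ρ => (ih _).1
        have h2 : ∑ ρ, θ.fb S ρ * V (⟨S, ρ⟩ :: h) ≤
            ∑ ρ, θ.fb S ρ * Real.log (W (⟨S, ρ⟩ :: h)) :=
          Finset.sum_le_sum fun ρ _ => mul_le_mul_of_nonneg_left (ih _).2 (θ.fb_pos S ρ).le
        have h3 := hc S
        simp only [F, Sum.elim_inl]
        linarith
      · simp [F, decisionEquiv]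
    rw [hW]
    exact ⟨sum_mul_pos_of_sum_eq_one (fun x => A.prob_nonneg _ _) (A.sum_prob h) hF,
      hV.trans (sum_mul_log_le_log_sum (fun x => A.prob_nonneg _ _) (A.sum_prob h) hF)⟩

end Algorithm

/-! ### Sums over histories, graded by length. -/

/-- Sum of `φ` over the lists of length `m`. -/
def levelSum {R M : Type*} [Fintype R] [AddCommMonoid M] (m : ℕ) (φ : List R → M) : M :=
  ∑ v : List.Vector R m, φ v.1

section levelSum

variable {R : Type*} [Fintype R]

theorem levelSum_zero {M : Type*} [AddCommMonoid M] (φ : List R → M) :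
    levelSum 0 φ = φ [] := by
  unfold levelSum
  rw [Fintype.sum_subsingleton _ List.Vector.nil]
  rfl

theorem levelSum_succ {M : Type*} [AddCommMonoid M] (m : ℕ) (φ : List R → M) :
    levelSum (m + 1) φ = levelSum m fun h => ∑ r, φ (r :: h) := by
  unfold levelSum
  rw [Finset.sum_comm, ← Fintype.sum_prod_type' fun r (v : List.Vector R m) => φ (r :: v.1)]
  symm
  refine Fintype.sum_equiv
    { toFun := fun x => List.Vector.cons x.1 x.2
      invFun := fun v => (v.head, v.tail)
      left_inv := fun x => by simp
      right_inv := fun v => by simp } _ _ ?_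
  rintro ⟨r, v⟩
  cases v
  rfl

theorem tsum_list_eq_tsum_levelSum (φ : List R → ℝ≥0∞) :
    ∑' h, φ h = ∑' m, levelSum m φ := by
  rw [← (Equiv.sigmaFiberEquiv (List.length : List R → ℕ)).tsum_eq, ENNReal.tsum_sigma']
  refine tsum_congr fun m => ?_
  exact tsum_fintype (L := .unconditional _) fun v : List.Vector R m => φ v.1

theorem levelSum_length_mul (m : ℕ) (φ : List R → ℝ≥0∞) :
    levelSum m (fun h => (h.length : ℝ≥0∞) * φ h) = m * levelSum m φ := by
  unfold levelSum
  rw [Finset.mul_sum]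
  exact Finset.sum_congr rfl fun v _ => congrArg (fun j : ℕ => (j : ℝ≥0∞) * φ v.1) v.2

end levelSum

/-! ### Survival probabilities and the expected number of rounds. -/

namespace Algorithm

variable (A : Algorithm n k) (θ : Instance n)

theorem reachProb_ne_top : ∀ h, A.reachProb θ h ≠ ⊤
  | [] => ENNReal.one_ne_top
  | _ :: h => ENNReal.mul_ne_top (ENNReal.mul_ne_top (reachProb_ne_top h) (PMF.apply_ne_top _ _))
      (PMF.apply_ne_top _ _)

/-- Probability that the first rounds played are those of the history, as a real number. -/
noncomputable def reach (h : List (Round n k)) : ℝ := (A.reachProb θ h).toReal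

theorem reach_nonneg (h : List (Round n k)) : 0 ≤ A.reach θ h := ENNReal.toReal_nonneg

theorem reach_nil : A.reach θ [] = 1 := by simp [reach, reachProb]

theorem reach_cons (S : Query n k) (ρ : S.1 ≃ Fin k) (h : List (Round n k)) :
    A.reach θ (⟨S, ρ⟩ :: h) = A.reach θ h * A.prob h (.play S) * θ.fb S ρ := by
  simp only [reach, reachProb, ENNReal.toReal_mul, Instance.toReal_feedback, prob]

theorem toReal_stopProb (h : List (Round n k)) (σ : Equiv.Perm (Fin n)) :
    (A.stopProb θ h σ).toReal = A.reach θ h * A.prob h (.output σ) := by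
  simp only [stopProb, ENNReal.toReal_mul, reach, prob]

theorem stopProb_eq_ofReal (h : List (Round n k)) (σ : Equiv.Perm (Fin n)) :
    A.stopProb θ h σ = ENNReal.ofReal (A.reach θ h * A.prob h (.output σ)) := by
  rw [← toReal_stopProb, ENNReal.ofReal_toReal]
  exact ENNReal.mul_ne_top (A.reachProb_ne_top θ h) (PMF.apply_ne_top _ _)

/-- Expected reward for the output when the algorithm stops after exactly `m` rounds. -/
noncomputable def stopSum (u : Equiv.Perm (Fin n) → ℝ) (m : ℕ) : ℝ :=
  levelSum m fun h => A.reach θ h * ∑ σ, A.prob h (.output σ) * u σ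

/-- Expected reward for the set played after exactly `m` rounds. -/
noncomputable def playSum (c : Query n k → ℝ) (m : ℕ) : ℝ :=
  levelSum m fun h => A.reach θ h * ∑ S, A.prob h (.play S) * c S

/-- Probability of playing at least `m` rounds. -/
noncomputable def surv (m : ℕ) : ℝ := levelSum m (A.reach θ)

theorem surv_nonneg (m : ℕ) : 0 ≤ A.surv θ m :=
  Finset.sum_nonneg fun _ _ => A.reach_nonneg θ _

/-- Tower property: condition on all rounds but the latest. -/
theorem levelSum_reach_mul_succ (m : ℕ) (f : List (Round n k) → ℝ) :
    levelSum (m + 1) (fun h => A.reach θ h * f h) = levelSum m fun h =>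
      A.reach θ h * ∑ S, A.prob h (.play S) * ∑ ρ, θ.fb S ρ * f (⟨S, ρ⟩ :: h) := by
  rw [levelSum_succ]
  congr 1
  funext h
  rw [Fintype.sum_sigma, Finset.mul_sum]
  refine Finset.sum_congr rfl fun S _ => ?_
  rw [Finset.mul_sum, Finset.mul_sum]
  refine Finset.sum_congr rfl fun ρ _ => ?_
  rw [reach_cons]
  ring

theorem surv_zero : A.surv θ 0 = 1 := by
  rw [surv, levelSum_zero, reach_nil]

theorem playSum_one (m : ℕ) : A.playSum θ (fun _ => 1) m = A.surv θ (m + 1) := by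
  have h := A.levelSum_reach_mul_succ θ m fun _ => 1
  simp only [mul_one, Instance.sum_fb] at h
  simp only [playSum, mul_one]
  exact h.symm

theorem surv_eq_stopSum_add (m : ℕ) :
    A.surv θ m = A.stopSum θ (fun _ => 1) m + A.surv θ (m + 1) := by
  rw [← playSum_one]
  simp only [surv, stopSum, playSum, levelSum, mul_one]
  rw [← Finset.sum_add_distrib]
  refine Finset.sum_congr rfl fun v _ => ?_
  rw [← mul_add, add_comm, sum_prob_add, mul_one]

theorem levelSum_reach_mul_value_succ (u : Equiv.Perm (Fin n) → ℝ) (c : Query n k → ℝ) (b : ℝ)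
    (M m : ℕ) :
    levelSum m (fun h => A.reach θ h * A.value θ u c b (M + 1) h) =
      A.playSum θ c m + A.stopSum θ u m +
        levelSum (m + 1) (fun h => A.reach θ h * A.value θ u c b M h) := by
  rw [levelSum_reach_mul_succ]
  simp only [playSum, stopSum, levelSum, value]
  rw [← Finset.sum_add_distrib, ← Finset.sum_add_distrib]
  refine Finset.sum_congr rfl fun v _ => ?_
  simp only [mul_add, Finset.sum_add_distrib]
  ring

/-- Links the backward recursion, suited to induction, with forward sums over rounds, suited to
limits. -/
theorem value_nil (u : Equiv.Perm (Fin n) → ℝ) (c : Query n k → ℝ) (b : ℝ) (M : ℕ) :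
    A.value θ u c b M [] =
      ∑ m ∈ Finset.range M, (A.playSum θ c m + A.stopSum θ u m) + b * A.surv θ M := by
  -- `j` counts the levels already unrolled from the root, `M` the decisions left.
  have key : ∀ j M, A.value θ u c b (M + j) [] =
      ∑ m ∈ Finset.range j, (A.playSum θ c m + A.stopSum θ u m) +
        levelSum j (fun h => A.reach θ h * A.value θ u c b M h) := by
    intro j
    induction j with
    | zero => intro M; simp [levelSum_zero, reach_nil]
    | succ j ih =>
      intro M
      rw [show M + (j + 1) = M + 1 + j by ring, ih, levelSum_reach_mul_value_succ,
        Finset.sum_range_succ]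
      ring
  have h := key M 0
  rw [zero_add] at h
  rw [h, surv, levelSum, levelSum, Finset.mul_sum]
  simp only [value, mul_comm]

theorem sum_stopSum_one_add_surv (M : ℕ) :
    ∑ m ∈ Finset.range M, A.stopSum θ (fun _ => 1) m + A.surv θ M = 1 := by
  induction M with
  | zero => simp [surv_zero]
  | succ M ih =>
    rw [A.surv_eq_stopSum_add θ M] at ih
    rw [Finset.sum_range_succ]
    linarith

/-- Both sides compute the mean of the number of rounds capped at `M`. -/
theorem sum_surv_succ (M : ℕ) :
    ∑ m ∈ Finset.range M, A.surv θ (m + 1) =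
      ∑ m ∈ Finset.range M, m * A.stopSum θ (fun _ => 1) m + M * A.surv θ M := by
  induction M with
  | zero => simp
  | succ M ih =>
    rw [Finset.sum_range_succ, Finset.sum_range_succ, ih, A.surv_eq_stopSum_add θ M]
    push_cast
    ring

theorem stopSum_nonneg {u : Equiv.Perm (Fin n) → ℝ} (hu : ∀ σ, 0 ≤ u σ) (m : ℕ) :
    0 ≤ A.stopSum θ u m :=
  Finset.sum_nonneg fun _ _ => mul_nonneg (A.reach_nonneg θ _) <|
    Finset.sum_nonneg fun σ _ => mul_nonneg (A.prob_nonneg _ _) (hu σ)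

theorem levelSum_sum_stopProb (m : ℕ) :
    levelSum m (fun h => ∑ σ, A.stopProb θ h σ) =
      ENNReal.ofReal (A.stopSum θ (fun _ => 1) m) := by
  have h0 : ∀ h σ, 0 ≤ A.reach θ h * A.prob h (.output σ) := fun h σ =>
    mul_nonneg (A.reach_nonneg θ h) (A.prob_nonneg _ _)
  simp only [stopProb_eq_ofReal, levelSum, stopSum, mul_one, Finset.mul_sum]
  rw [ENNReal.ofReal_sum_of_nonneg fun v _ => Finset.sum_nonneg fun σ _ => h0 _ _]
  exact Finset.sum_congr rfl fun v _ =>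
    (ENNReal.ofReal_sum_of_nonneg fun σ _ => h0 _ _).symm

/-- Probability of the output `σ`, as a real number. -/
noncomputable def out (σ : Equiv.Perm (Fin n)) : ℝ := (A.outputProb θ σ).toReal

theorem outputProb_ne_top (h1 : A.haltProb θ = 1) (σ : Equiv.Perm (Fin n)) :
    A.outputProb θ σ ≠ ⊤ := by
  refine ne_top_of_le_ne_top ENNReal.one_ne_top (h1 ▸ ?_)
  exact Finset.single_le_sum (f := A.outputProb θ) (fun _ _ => zero_le) (Finset.mem_univ σ)

/-- Groups histories by length; halting makes the output probabilities finite, so the series passes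
to the reals. -/
theorem hasSum_stopSum (h1 : A.haltProb θ = 1) (u : Equiv.Perm (Fin n) → ℝ) :
    HasSum (A.stopSum θ u) (∑ σ, A.out θ σ * u σ) := by
  have hσ : ∀ σ, HasSum (fun m => levelSum m fun h => A.reach θ h * A.prob h (.output σ))
      (A.out θ σ) := by
    intro σ
    have hne := A.outputProb_ne_top θ h1 σ
    have heq : A.outputProb θ σ = ∑' m, levelSum m fun h => A.stopProb θ h σ :=
      tsum_list_eq_tsum_levelSum _
    have hs := ENNReal.hasSum_toReal (heq ▸ hne)
    have hout : A.out θ σ = ∑' m, (levelSum m fun h => A.stopProb θ h σ).toReal := by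
      rw [out, heq, ENNReal.tsum_toReal_eq (ENNReal.ne_top_of_tsum_ne_top (heq ▸ hne))]
    rw [hout]
    convert hs using 2 with m
    rw [levelSum, levelSum, ENNReal.toReal_sum]
    · exact Finset.sum_congr rfl fun v _ => (A.toReal_stopProb θ _ σ).symm
    · intro v _
      rw [stopProb_eq_ofReal]
      exact ENNReal.ofReal_ne_top
  have hs := hasSum_sum (s := Finset.univ) fun σ _ => (hσ σ).mul_right (u σ)
  refine (congrArg (HasSum · _) (funext fun m => ?_)).mpr hs
  simp only [stopSum, levelSum, Finset.mul_sum, Finset.sum_mul]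
  rw [Finset.sum_comm]
  simp only [mul_assoc]

theorem out_nonneg (σ : Equiv.Perm (Fin n)) : 0 ≤ A.out θ σ := ENNReal.toReal_nonneg

theorem sum_out (h1 : A.haltProb θ = 1) : ∑ σ, A.out θ σ = 1 := by
  unfold out
  rw [← ENNReal.toReal_sum fun σ _ => A.outputProb_ne_top θ h1 σ]
  change (A.haltProb θ).toReal = 1
  rw [h1, ENNReal.toReal_one]

/-- The expected number of rounds dominates the truncated sums of survival probabilities. -/
theorem ofReal_sum_surv_le_expectedRounds (h1 : A.haltProb θ = 1) (M : ℕ) :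
    ENNReal.ofReal (∑ m ∈ Finset.range M, A.surv θ (m + 1)) ≤ A.expectedRounds θ := by
  set q := A.stopSum θ fun _ => 1 with hq
  have hq0 : ∀ m, 0 ≤ q m := A.stopSum_nonneg θ fun _ => zero_le_one
  have hsum := A.hasSum_stopSum θ h1 fun _ => 1
  simp only [mul_one, A.sum_out θ h1] at hsum
  rw [← hq] at hsum
  -- Since the algorithm halts almost surely, surviving to round `M` means stopping at some later or
  -- equal time.
  have htail : ∑' j, ENNReal.ofReal (q (j + M)) = ENNReal.ofReal (A.surv θ M) := by
    rw [← ENNReal.ofReal_tsum_of_nonneg (fun j => hq0 _) ((summable_nat_add_iff M).2 hsum.summable)]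
    congr 1
    have ha := hsum.summable.sum_add_tsum_nat_add M
    have hb := A.sum_stopSum_one_add_surv θ M
    rw [hsum.tsum_eq] at ha
    rw [← hq] at hb
    linarith
  have hE : A.expectedRounds θ = ∑' m : ℕ, (m : ℝ≥0∞) * ENNReal.ofReal (q m) := by
    rw [expectedRounds, h1, tsub_self, mul_zero, add_zero, tsum_list_eq_tsum_levelSum]
    exact tsum_congr fun m => by rw [levelSum_length_mul, levelSum_sum_stopProb]
  have hsplit : ∑' m : ℕ, (m : ℝ≥0∞) * ENNReal.ofReal (q m) =
      ∑ m ∈ Finset.range M, (m : ℝ≥0∞) * ENNReal.ofReal (q m) +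
        ∑' j : ℕ, ((j + M : ℕ) : ℝ≥0∞) * ENNReal.ofReal (q (j + M)) :=
    (ENNReal.summable.sum_add_tsum_nat_add' (f := fun m : ℕ => (m : ℝ≥0∞) * ENNReal.ofReal (q m))
      (k := M)).symm
  rw [sum_surv_succ, hE, hsplit, ENNReal.ofReal_add
      (Finset.sum_nonneg fun m _ => mul_nonneg m.cast_nonneg (hq0 m))
      (mul_nonneg M.cast_nonneg (A.surv_nonneg θ M))]
  -- Terms below `M` agree; in the tail each length is at least `M`.
  refine add_le_add (le_of_eq ?_) ?_
  · rw [ENNReal.ofReal_sum_of_nonneg fun m _ => mul_nonneg m.cast_nonneg (hq0 m)]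
    refine Finset.sum_congr rfl fun m _ => ?_
    rw [ENNReal.ofReal_mul m.cast_nonneg, ENNReal.ofReal_natCast]
  · rw [ENNReal.ofReal_mul M.cast_nonneg, ENNReal.ofReal_natCast, ← htail, ← ENNReal.tsum_mul_left]
    refine ENNReal.tsum_le_tsum fun j => ?_
    gcongr
    omega

end Algorithm

/-! ### The hard instances. -/

/-- From `log x ≥ 1 - 1 / x`, the left side is at most `(x - 1) ^ 2 / x`. -/
theorem sub_one_sub_log_le_sq {x : ℝ} (hx : 1 ≤ x) : x - 1 - Real.log x ≤ (x - 1) ^ 2 := by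
  have h0 : 0 < x := by linarith
  have h := Real.log_le_sub_one_of_pos (inv_pos.2 h0)
  rw [Real.log_inv] at h
  have h2 : (x - 1) ^ 2 - (x - 1) - (x⁻¹ - 1) = (x - 1) ^ 2 * ((x - 1) / x) := by
    field_simp
    ring
  have h3 : 0 ≤ (x - 1) ^ 2 * ((x - 1) / x) :=
    mul_nonneg (sq_nonneg _) (div_nonneg (by linarith) h0.le)
  linarith

/-- The relative entropy of the feedback is bounded through the scores, up to rescaling. -/
theorem Instance.sum_fb_mul_log_le (θ θ' : Instance n) {r : ℝ} (hr : 0 < r) (S : Query n k) :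
    ∑ ρ, θ.fb S ρ * Real.log (θ.fb S ρ / θ'.fb S ρ) ≤
      ∑ a ∈ S.1, (r * θ'.score a / θ.score a - 1 - Real.log (r * θ'.score a / θ.score a)) := by
  have h := sum_rankProb_mul_log_le (by simpa using S.2) (fun a : S.1 => θ.score a)
    (fun a : S.1 => r * θ'.score a) (fun a => θ.score_pos a)
    (fun a => mul_pos hr (θ'.score_pos a))
  simp only [rankProb_const_mul _ hr.ne'] at h
  refine h.trans_eq ?_
  exact Finset.sum_coe_sort S.1
    fun a => r * θ'.score a / θ.score a - 1 - Real.log (r * θ'.score a / θ.score a)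

/-- Item `z` has score `1`, and all others lie between `(1 - ε) ^ 2` and `1 - ε`. -/
noncomputable def baseScore (z : Fin n) (ε : ℝ) (j : Fin n) : ℝ :=
  if j = z then 1 else (1 - ε) * (1 - ε * (j / n))

theorem baseScore_of_ne {z j : Fin n} (ε : ℝ) (h : j ≠ z) :
    baseScore z ε j = (1 - ε) * (1 - ε * (j / n)) := if_neg h

theorem baseScore_self (z : Fin n) (ε : ℝ) : baseScore z ε z = 1 := if_pos rfl

section baseScore

variable {z : Fin n} {ε : ℝ}

theorem baseScore_le_of_ne (h0 : 0 < ε) (h1 : ε < 1) {j : Fin n} (h : j ≠ z) :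
    baseScore z ε j ≤ 1 - ε := by
  rw [baseScore_of_ne ε h]
  have : 0 ≤ ε * ((j : ℝ) / n) := by positivity
  nlinarith

theorem sq_le_baseScore_of_ne (h0 : 0 < ε) (h1 : ε < 1) {j : Fin n} (h : j ≠ z) :
    (1 - ε) ^ 2 ≤ baseScore z ε j := by
  rw [baseScore_of_ne ε h, sq]
  have hj : (j : ℝ) / n ≤ 1 := div_le_one_of_le₀ (by exact_mod_cast j.2.le) (Nat.cast_nonneg n)
  refine mul_le_mul_of_nonneg_left ?_ (by linarith)
  nlinarith

theorem baseScore_pos (h0 : 0 < ε) (h1 : ε < 1) (j : Fin n) : 0 < baseScore z ε j := by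
  by_cases h : j = z
  · rw [h, baseScore_self]; exact one_pos
  · exact (pow_pos (by linarith) 2).trans_le (sq_le_baseScore_of_ne h0 h1 h)

theorem baseScore_le_one (h0 : 0 < ε) (h1 : ε < 1) (j : Fin n) : baseScore z ε j ≤ 1 := by
  by_cases h : j = z
  · rw [h, baseScore_self]
  · linarith [baseScore_le_of_ne h0 h1 h]

/-- The tilt by `j / n` is there only to separate the items other than `z`; the gap `ε` separates
`z`. -/
theorem baseScore_injective (h0 : 0 < ε) (h1 : ε < 1) : Function.Injective (baseScore z ε) := by
  intro a b hab
  by_cases ha : a = z <;> by_cases hb : b = z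
  · rw [ha, hb]
  · rw [ha, baseScore_self] at hab
    linarith [baseScore_le_of_ne h0 h1 hb]
  · rw [hb, baseScore_self] at hab
    linarith [baseScore_le_of_ne h0 h1 ha]
  · rw [baseScore_of_ne ε ha, baseScore_of_ne ε hb] at hab
    have hn : (n : ℝ) ≠ 0 := Nat.cast_ne_zero.2 (Fin.pos a).ne'
    have h2 := mul_left_cancel₀ (by linarith : (1 - ε) ≠ 0) hab
    have h3 : (a : ℝ) / n = b / n := mul_left_cancel₀ h0.ne' (by linarith)
    rw [div_left_inj' hn] at h3
    exact Fin.ext (by exact_mod_cast h3)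

end baseScore

/-- The instance with the scores `baseScore z ε`. -/
noncomputable def baseInstance (z : Fin n) {ε : ℝ} (h0 : 0 < ε) (h1 : ε < 1) : Instance n where
  score := baseScore z ε
  score_pos := baseScore_pos h0 h1
  score_le_one := baseScore_le_one h0 h1
  exists_score_eq_one := ⟨z, baseScore_self z ε⟩
  score_injective := baseScore_injective h0 h1

/-- The base instance with the item `i` raised above all the others. -/
noncomputable def raisedInstance (z : Fin n) {ε : ℝ} (h0 : 0 < ε) (h1 : ε < 1) (i : Fin n) :
    Instance n where
  score j := if j = i then 1 else (1 - ε) * baseScore z ε j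
  score_pos j := by
    split_ifs
    · exact one_pos
    · exact mul_pos (by linarith) (baseScore_pos h0 h1 j)
  score_le_one j := by
    split_ifs
    · exact le_rfl
    · nlinarith [baseScore_pos h0 h1 (z := z) j, baseScore_le_one h0 h1 (z := z) j]
  exists_score_eq_one := ⟨i, if_pos rfl⟩
  score_injective := by
    have hlt : ∀ j, (1 - ε) * baseScore z ε j < 1 := fun j => by
      nlinarith [baseScore_pos h0 h1 (z := z) j, baseScore_le_one h0 h1 (z := z) j]
    intro a b hab
    simp only at hab
    split_ifs at hab with ha hb hb
    · rw [ha, hb]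
    · exact absurd hab.symm (hlt b).ne
    · exact absurd hab (hlt a).ne
    · exact baseScore_injective h0 h1 (mul_left_cancel₀ (by linarith : (1 - ε) ≠ 0) hab)

/-- Bounds the weight ratio of the raised item; the 8 becomes 64 after squaring. -/
theorem one_div_cube_le {ε : ℝ} (h0 : 0 ≤ ε) (h1 : ε ≤ 9 / 25) :
    1 / (1 - ε) ^ 3 ≤ 1 + 8 * ε := by
  have : 0 < 1 - ε := by linarith
  rw [div_le_iff₀ (pow_pos this 3)]
  have h : (1 + 8 * ε) * (1 - ε) ^ 3 - 1 =
      ε * (5 - 21 * ε + 23 * ε ^ 2 - 8 * ε ^ 3) := by ring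
  have h2 : 0 ≤ 5 - 21 * ε + 23 * ε ^ 2 - 8 * ε ^ 3 := by
    nlinarith [mul_nonneg h0 (sub_nonneg.2 h1), mul_nonneg (mul_nonneg h0 h0) (sub_nonneg.2 h1),
      sq_nonneg (ε - 9 / 25)]
  nlinarith [mul_nonneg h0 h2]

theorem sum_fb_base_raised_le {z i : Fin n} {ε : ℝ} (h0 : 0 < ε) (h1 : ε < 1)
    (hε : ε ≤ 9 / 25) (hi : i ≠ z) (S : Query n k) :
    ∑ ρ, (baseInstance z h0 h1).fb S ρ *
        Real.log ((baseInstance z h0 h1).fb S ρ / (raisedInstance z h0 h1 i).fb S ρ) ≤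
      if i ∈ S.1 then 64 * ε ^ 2 else 0 := by
  have hpos : 0 < 1 - ε := by linarith
  -- Rescaling the raised scores by `(1 - ε)⁻¹` gives every item but `i` ratio 1, hence no
  -- contribution.
  refine ((baseInstance z h0 h1).sum_fb_mul_log_le (raisedInstance z h0 h1 i)
    (inv_pos.2 hpos) S).trans ?_
  have hne : ∀ a, a ≠ i → (1 - ε)⁻¹ * (raisedInstance z h0 h1 i).score a /
      (baseInstance z h0 h1).score a = 1 := by
    intro a ha
    simp only [raisedInstance, baseInstance, if_neg ha]
    rw [inv_mul_cancel_left₀ hpos.ne', div_self (baseScore_pos h0 h1 a).ne']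
  have hzero : ∀ a, a ≠ i → (1 - ε)⁻¹ * (raisedInstance z h0 h1 i).score a /
      (baseInstance z h0 h1).score a - 1 - Real.log ((1 - ε)⁻¹ *
        (raisedInstance z h0 h1 i).score a / (baseInstance z h0 h1).score a) = 0 := by
    intro a ha
    rw [hne a ha]
    simp
  split_ifs with hS
  · rw [Finset.sum_eq_single_of_mem i hS fun a _ ha => hzero a ha]
    simp only [raisedInstance, baseInstance, if_pos, mul_one]
    set s := baseScore z ε i
    have hs0 : 0 < s := baseScore_pos h0 h1 i
    have hs1 : s ≤ 1 - ε := baseScore_le_of_ne h0 h1 hi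
    have hs2 : (1 - ε) ^ 2 ≤ s := sq_le_baseScore_of_ne h0 h1 hi
    have hx : (1 - ε)⁻¹ / s = 1 / ((1 - ε) * s) := by field_simp
    have hx1 : 1 ≤ (1 - ε)⁻¹ / s := by
      rw [hx, le_div_iff₀ (mul_pos hpos hs0)]
      nlinarith
    have hx2 : (1 - ε)⁻¹ / s ≤ 1 + 8 * ε := by
      refine le_trans ?_ (one_div_cube_le h0.le hε)
      rw [hx]
      refine one_div_le_one_div_of_le (pow_pos hpos 3) ?_
      rw [pow_succ']
      exact mul_le_mul_of_nonneg_left hs2 hpos.le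
    refine (sub_one_sub_log_le_sq hx1).trans ?_
    nlinarith
  · refine (Finset.sum_eq_zero fun a ha => hzero a ?_).le
    rintro rfl
    exact hS ha

theorem apply_lt_of_isEpsBestRanking_base {z i : Fin n} {ε : ℝ} (h0 : 0 < ε) (h1 : ε < 1)
    (hi : i ≠ z) {σ : Equiv.Perm (Fin n)}
    (h : IsEpsBestRanking ε (baseInstance z h0 h1) σ) : σ z < σ i := by
  refine (not_lt.1 fun hlt => h ⟨z, i, hlt, ?_⟩).lt_of_ne fun he => hi (σ.injective he.symm)
  simp only [baseInstance, baseScore_self]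
  linarith [baseScore_le_of_ne h0 h1 hi]

/-- Scaling leaves `z` at `1 - ε`, exactly `ε` below `i`. -/
theorem not_apply_lt_of_isEpsBestRanking_raised {z i : Fin n} {ε : ℝ} (h0 : 0 < ε) (h1 : ε < 1)
    (hi : i ≠ z) {σ : Equiv.Perm (Fin n)}
    (h : IsEpsBestRanking ε (raisedInstance z h0 h1 i) σ) : ¬ σ z < σ i := by
  refine fun hlt => h ⟨i, z, hlt, ?_⟩
  simp only [raisedInstance, if_pos, if_neg hi.symm, baseScore_self]
  linarith

/-! ### The lower bound on the number of rounds. -/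

namespace Algorithm

variable (A : Algorithm n k)

open Classical in
theorem IsPACRank.le_sum_out {A : Algorithm n k} {ε δ : ℝ} (hA : A.IsPACRank ε δ)
    (θ : Instance n) :
    1 - δ ≤ ∑ σ with IsEpsBestRanking ε θ σ, A.out θ σ := by
  obtain ⟨h1, h2⟩ := hA θ
  have h3 : ∑ σ with IsEpsBestRanking ε θ σ, A.outputProb θ σ ≠ ⊤ :=
    ENNReal.sum_ne_top.2 fun σ _ => A.outputProb_ne_top θ h1 σ
  have h4 := (ENNReal.ofReal_le_iff_le_toReal h3).1 h2
  rwa [ENNReal.toReal_sum fun σ _ => A.outputProb_ne_top θ h1 σ] at h4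

open Classical in
/-- If a set of outputs has probability at most `δ` under `θ'`, then telling `θ` and `θ'` apart
costs relative entropy under `θ`. -/
theorem change_of_measure {θ θ' : Instance n} (h' : A.haltProb θ' = 1) {c : Query n k → ℝ}
    (hc : ∀ S, ∑ ρ, θ.fb S ρ * Real.log (θ.fb S ρ / θ'.fb S ρ) ≤ c S)
    {δ : ℝ} (hδ : 0 < δ) (hδ1 : δ ≤ 1) {E : Set (Equiv.Perm (Fin n))}
    (hE : ∑ σ with σ ∈ E, A.out θ' σ ≤ δ) (M : ℕ) :
    Real.log (1 / δ) * ∑ m ∈ Finset.range M, A.stopSum θ (E.indicator 1) m - Real.log 2 ≤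
      ∑ m ∈ Finset.range M, A.playSum θ c m := by
  -- With this reward, `exp u` is `1 / δ` on `E` and 1 elsewhere, so its mean under `θ'` is at most
  -- `1 + (1 / δ - 1) * δ ≤ 2`; this is the source of `log 2`.
  set s := Real.log (1 / δ) with hs
  set u : Equiv.Perm (Fin n) → ℝ := fun σ => s * E.indicator 1 σ with hu
  have hexp : (fun σ => Real.exp (u σ)) = fun σ => 1 + (1 / δ - 1) * E.indicator 1 σ := by
    funext σ
    by_cases h : σ ∈ E
    · simp only [hu, Set.indicator_of_mem h, Pi.one_apply, mul_one, hs]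
      rw [Real.exp_log (one_div_pos.2 hδ)]
      ring
    · simp [hu, Set.indicator_of_notMem h]
  obtain ⟨hpos, hle⟩ := A.value_le_log_value θ θ' u c hc M []
  rw [hexp, value_nil] at hpos hle
  rw [value_nil] at hle
  have hlin : ∀ m, A.stopSum θ' (fun σ => 1 + (1 / δ - 1) * E.indicator 1 σ) m =
      A.stopSum θ' (fun _ => 1) m + (1 / δ - 1) * A.stopSum θ' (E.indicator 1) m := by
    intro m
    simp only [stopSum, levelSum]
    rw [Finset.mul_sum, ← Finset.sum_add_distrib]
    refine Finset.sum_congr rfl fun v _ => ?_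
    simp only [mul_add, Finset.sum_add_distrib, Finset.mul_sum]
    congr 1
    exact Finset.sum_congr rfl fun σ _ => by ring
  have hscal : ∀ m, A.stopSum θ u m = s * A.stopSum θ (E.indicator 1) m := by
    intro m
    simp only [stopSum, levelSum, Finset.mul_sum, hu]
    exact Finset.sum_congr rfl fun v _ => Finset.sum_congr rfl fun σ _ => by ring
  have hneg : ∀ m, A.playSum θ (fun S => - c S) m = - A.playSum θ c m := by
    intro m
    simp only [playSum, levelSum, mul_neg, Finset.sum_neg_distrib]
  have hzero : ∀ m, A.playSum θ' 0 m = 0 := by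
    intro m
    simp [playSum, levelSum]
  have h01 : ∀ σ, (0 : ℝ) ≤ E.indicator 1 σ := fun σ =>
    Set.indicator_nonneg (fun _ _ => zero_le_one) σ
  have hQ : ∑ m ∈ Finset.range M, A.stopSum θ' (E.indicator 1) m ≤ δ := by
    refine (sum_le_hasSum _ (fun m _ => A.stopSum_nonneg θ' h01 m)
      (A.hasSum_stopSum θ' h' _)).trans (le_trans (le_of_eq ?_) hE)
    rw [Finset.sum_filter]
    refine Finset.sum_congr rfl fun σ _ => ?_
    by_cases h : σ ∈ E <;> simp [h]
  simp only [hlin, hscal, hneg, hzero, zero_add, zero_mul, add_zero, one_mul,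
    Finset.sum_add_distrib, Finset.sum_neg_distrib, ← Finset.mul_sum] at hpos hle
  -- The constant part of the reward, with the terminal reward 1 of unfinished runs, has total mass
  -- exactly 1.
  have hone := A.sum_stopSum_one_add_surv θ' M
  have hδ' : 0 ≤ 1 / δ - 1 := by
    rw [sub_nonneg, le_div_iff₀ hδ]
    linarith
  have htwo := mul_le_mul_of_nonneg_left hQ hδ'
  have hδδ : (1 / δ - 1) * δ = 1 - δ := by field_simp
  have hlog := Real.log_le_log hpos (y := 2) (by linarith)
  linarith

/-- Double counting: a played set contains at most `k` items of `T`. -/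
theorem sum_playSum_mem_le (θ : Instance n) (T : Finset (Fin n)) {a : ℝ} (ha : 0 ≤ a) (m : ℕ) :
    ∑ i ∈ T, A.playSum θ (fun S => if i ∈ S.1 then a else 0) m ≤ a * k * A.surv θ (m + 1) := by
  rw [← playSum_one]
  simp only [playSum, levelSum]
  rw [Finset.sum_comm, Finset.mul_sum]
  refine Finset.sum_le_sum fun v _ => ?_
  rw [← Finset.mul_sum, mul_left_comm]
  refine mul_le_mul_of_nonneg_left ?_ (A.reach_nonneg θ _)
  rw [Finset.sum_comm, Finset.mul_sum]
  refine Finset.sum_le_sum fun S _ => ?_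
  rw [← Finset.mul_sum, mul_left_comm, mul_one]
  refine mul_le_mul_of_nonneg_left ?_ (A.prob_nonneg _ _)
  rw [← Finset.sum_filter, Finset.sum_const, nsmul_eq_mul, mul_comm]
  refine mul_le_mul_of_nonneg_left ?_ ha
  have : (T.filter fun i => i ∈ S.1).card ≤ S.1.card :=
    Finset.card_le_card fun i hi => (Finset.mem_filter.1 hi).2
  rw [S.2] at this
  exact_mod_cast this

/-- Every algorithm that finds an `ε`-best ranking has a large expected number of rounds. -/
theorem IsPACRank.le_expectedRounds {A : Algorithm n k} {ε δ : ℝ} (hA : A.IsPACRank ε δ)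
    (z : Fin n) (h0 : 0 < ε) (h1 : ε < 1) (hε : ε ≤ 9 / 25) (hk : 0 < k) (hδ : 0 < δ)
    (hδ1 : δ ≤ 1) :
    ENNReal.ofReal ((n - 1) * (Real.log (1 / δ) * (1 - δ) - Real.log 2) / (64 * ε ^ 2 * k)) ≤
      A.expectedRounds (baseInstance z h0 h1) := by
  classical
  set θ := baseInstance z h0 h1 with hθ
  set B : Set (Equiv.Perm (Fin n)) := {σ | IsEpsBestRanking ε θ σ} with hB
  set T : Finset (Fin n) := Finset.univ.erase z with hT
  have hTcard : (T.card : ℝ) = n - 1 := by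
    rw [hT, Finset.card_erase_of_mem (Finset.mem_univ z), Finset.card_univ, Fintype.card_fin,
      Nat.cast_sub (Fin.pos z), Nat.cast_one]
  have hs : 0 ≤ Real.log (1 / δ) := Real.log_nonneg (by rwa [le_div_iff₀ hδ, one_mul])
  have hden : (0 : ℝ) < 64 * ε ^ 2 * k := by positivity
  have hM : ∀ M, (n - 1) * (Real.log (1 / δ) *
      ∑ m ∈ Finset.range M, A.stopSum θ (B.indicator 1) m - Real.log 2) / (64 * ε ^ 2 * k) ≤
      ∑ m ∈ Finset.range M, A.surv θ (m + 1) := by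
    intro M
    rw [div_le_iff₀ hden, mul_comm (∑ m ∈ Finset.range M, A.surv θ (m + 1)),
      Finset.mul_sum _ _ (64 * ε ^ 2 * (k : ℝ)),
      ← hTcard, ← nsmul_eq_mul, ← Finset.sum_const]
    refine le_trans ?_ (Finset.sum_le_sum fun m _ =>
      A.sum_playSum_mem_le θ T (a := 64 * ε ^ 2) (by positivity) m)
    rw [Finset.sum_comm]
    refine Finset.sum_le_sum fun i hi => ?_
    have hiz : i ≠ z := Finset.ne_of_mem_erase hi
    set θ' := raisedInstance z h0 h1 i with hθ'
    have hE : ∑ σ with σ ∈ {σ : Equiv.Perm (Fin n) | σ z < σ i}, A.out θ' σ ≤ δ := by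
      have ha := hA.le_sum_out θ'
      have hb := A.sum_out θ' (hA θ').1
      have hc : ∑ σ with σ ∈ {σ : Equiv.Perm (Fin n) | σ z < σ i}, A.out θ' σ ≤
          ∑ σ with ¬ IsEpsBestRanking ε θ' σ, A.out θ' σ := by
        refine Finset.sum_le_sum_of_subset_of_nonneg (fun σ hσ => ?_)
          fun σ _ _ => A.out_nonneg θ' σ
        simp only [Finset.mem_filter, Finset.mem_univ, true_and, Set.mem_ofPred_eq] at hσ ⊢
        exact fun hbest => not_apply_lt_of_isEpsBestRanking_raised h0 h1 hiz hbest hσ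
      have hd := Finset.sum_filter_add_sum_filter_not Finset.univ
        (fun σ => IsEpsBestRanking ε θ' σ) (A.out θ')
      linarith
    refine le_trans ?_ (A.change_of_measure (hA θ').1
      (fun S => sum_fb_base_raised_le h0 h1 hε hiz S) hδ hδ1
      (E := {σ | σ z < σ i}) (by convert hE) M)
    -- The event "`z` before `i`" contains `B`, which does not depend on `i`, so one limit in `M`
    -- serves all items.
    refine sub_le_sub_right (mul_le_mul_of_nonneg_left (Finset.sum_le_sum fun m _ => ?_) hs) _
    refine Finset.sum_le_sum fun v _ => mul_le_mul_of_nonneg_left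
      (Finset.sum_le_sum fun σ _ => mul_le_mul_of_nonneg_left ?_ (A.prob_nonneg _ _))
      (A.reach_nonneg θ _)
    exact Set.indicator_le_indicator_of_subset
      (fun σ hσ => apply_lt_of_isEpsBestRanking_base h0 h1 hiz hσ) (fun _ => zero_le_one) σ
  have hlim := (A.hasSum_stopSum θ (hA θ).1 (B.indicator 1)).tendsto_sum_nat
  have hBsum : 1 - δ ≤ ∑ σ, A.out θ σ * B.indicator 1 σ := by
    refine (hA.le_sum_out θ).trans_eq ?_
    rw [Finset.sum_filter]
    refine Finset.sum_congr rfl fun σ _ => ?_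
    by_cases h : IsEpsBestRanking ε θ σ <;> simp [hB, h]
  -- As `M` grows, the mass stopped in `B` tends to its full probability, at least `1 - δ`.
  have hlim2 := ENNReal.tendsto_ofReal
    ((((hlim.const_mul (Real.log (1 / δ))).sub_const (Real.log 2)).const_mul
      ((n : ℝ) - 1)).div_const (64 * ε ^ 2 * k))
  refine le_trans (ENNReal.ofReal_le_ofReal ?_) (le_of_tendsto' hlim2 fun M =>
    (ENNReal.ofReal_le_ofReal (hM M)).trans
      (A.ofReal_sum_surv_le_expectedRounds θ (hA θ).1 M))
  have hn : (0 : ℝ) ≤ n - 1 := hTcard ▸ Nat.cast_nonneg _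
  gcongr

end Algorithm

end PLRank

theorem mainTheorem7 :
    ∃ c : ℝ, 0 < c ∧
      ∀ (n k : ℕ), 3 ≤ n → 1 ≤ k → k ≤ n →
      ∀ ε ∈ Set.Ioc (0 : ℝ) (1 / Real.sqrt 8), ∀ δ ∈ Set.Ioc (0 : ℝ) 1,
      ∀ A : PLRank.Algorithm n k, A.IsSymmetric → A.IsPACRank ε δ →
        ∃ θ : PLRank.Instance n,
          ENNReal.ofReal (c * ((n : ℝ) / ((k : ℝ) * ε ^ 2)) * Real.log (1 / (4 * δ)))
            ≤ A.expectedRounds θ := by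
  -- The constant is `1 / 64` from the cost of a round times `1 / 4` from `hfinal`.
  refine ⟨1 / 256, by norm_num, fun n k hn hk _ ε hε δ hδ A _ hA => ?_⟩
  -- `9 / 25` is a rational just above `1 / √8`.
  have hε1 : ε ≤ 9 / 25 := by
    refine hε.2.trans ?_
    rw [div_le_iff₀ (by positivity), ← div_le_iff₀' (by norm_num)]
    exact Real.le_sqrt_of_sq_le (by norm_num)
  have hεlt : ε < 1 := by linarith
  refine ⟨PLRank.baseInstance ⟨0, by omega⟩ hε.1 hεlt, ?_⟩
  have hkpos : (0 : ℝ) < k := by exact_mod_cast hk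
  have hεpos : 0 < ε := hε.1
  have hδpos : 0 < δ := hδ.1
  have hn3 : (3 : ℝ) ≤ n := by exact_mod_cast hn
  -- For `δ ≥ 1 / 4` the logarithm is nonpositive and the bound is trivial.
  rcases le_total δ (1 / 4) with hδ4 | hδ4
  · refine le_trans (ENNReal.ofReal_le_ofReal ?_)
      (hA.le_expectedRounds ⟨0, by omega⟩ hε.1 hεlt hε1 hk hδ.1 hδ.2)
    set L := Real.log (1 / (4 * δ)) with hL
    have hL0 : 0 ≤ L := Real.log_nonneg (by rw [le_div_iff₀ (by positivity)]; linarith)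
    have hlog4 : Real.log 4 = 2 * Real.log 2 := by
      rw [show (4 : ℝ) = 2 ^ 2 by norm_num, Real.log_pow]
      norm_num
    have hLδ : Real.log (1 / δ) = L + 2 * Real.log 2 := by
      rw [← hlog4, hL, ← Real.log_mul (by positivity) (by norm_num)]
      congr 1
      field_simp
    have hlog2 : 0 < Real.log 2 := Real.log_pos one_lt_two
    -- As `1 - δ ≥ 3 / 4`, the term `2 * log 2` in `log (1 / δ)` contributes at least `3 / 2 * log
    -- 2`, which absorbs `log 2`.
    have hmain : 3 / 4 * L ≤ Real.log (1 / δ) * (1 - δ) - Real.log 2 := by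
      rw [hLδ]
      nlinarith
    have hfinal : (n : ℝ) / 4 * L ≤ (n - 1) * (Real.log (1 / δ) * (1 - δ) - Real.log 2) :=
      calc (n : ℝ) / 4 * L ≤ (n - 1) * (3 / 4 * L) := by nlinarith
        _ ≤ _ := mul_le_mul_of_nonneg_left hmain (by linarith)
    rw [le_div_iff₀ (by positivity)]
    refine le_trans (le_of_eq ?_) hfinal
    field_simp
    ring
  · have hL0 : Real.log (1 / (4 * δ)) ≤ 0 :=
      Real.log_nonpos (by positivity) (by rw [div_le_one (by positivity)]; linarith)
    rw [ENNReal.ofReal_of_nonpos (mul_nonpos_of_nonneg_of_nonpos (by positivity) hL0)]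
    exact zero_le
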